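/- Let $T\subset\mathbb{R}^2$ be a (nondegenerate, closed) triangle with area $|T|$, and let $F$ be one of its edges, with length $|F|$. For an integer $k\ge 0$ let $\mathbb{P}_k(T)$ be the space of real polynomials in two variables of total degree at most $k$, regarded as functions on $T$, and let $\Pi_T^k$ be the $L^2(T)$-orthogonal projection onto $\mathbb{P}_k(T)$; put $\Pi_T^{-1}:=0$. Let $p\ge 0$ and $n$ be integers with $-1\le n\le p$. Then for every $\xi\in\mathbb{P}_p(T)$ the polynomial $\theta:=\xi-\Pi_T^n\xi$ satisfies $$\|\theta\|_{L^2(F)}^2\le\frac{(p-n)(p+n+3)}{2}\,\frac{|F|}{|T|}\,\|\theta\|_{L^2(T)}^2,$$ where $L^2(F)$ is taken with respect to arc length on $F$ and $L^2(T)$ with respect to area on $T$. -/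

import Mathlib

open MeasureTheory

noncomputable section

namespace InverseTrace

/-- The Euclidean plane. -/
abbrev Plane : Type := EuclideanSpace ℝ (Fin 2)

/-- Real polynomials in two variables. -/
abbrev Poly : Type := MvPolynomial (Fin 2) ℝ

/-- The value of a polynomial at a point of the plane. -/
def value (q : Poly) (x : Plane) : ℝ := MvPolynomial.eval x.ofLp q

/-- The polynomials of total degree at most `p`. -/
abbrev polySpace (p : ℕ) : Submodule ℝ Poly := MvPolynomial.restrictTotalDegree (Fin 2) ℝ p

/-- The closed region bounded by a nondegenerate triangle. -/
def region (T : Affine.Triangle ℝ Plane) : Set Plane := convexHull ℝ (Set.range T.points)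

/-- The edge of `T` joining the vertices with the labels `i` and `j`. -/
def edge (T : Affine.Triangle ℝ Plane) (i j : Fin 3) : Set Plane :=
  segment ℝ (T.points i) (T.points j)

/-- The arc length measure in the plane. -/
def lengthMeasure : Measure Plane := Measure.hausdorffMeasure 1

/-- The squared `L²` norm of `q` on the triangle, for the area measure. -/
def normSqTriangle (T : Affine.Triangle ℝ Plane) (q : Poly) : ℝ :=
  ∫ x in region T, value q x ^ 2

/-- The squared `L²` norm of `q` on an edge, for the arc length measure. -/
def normSqEdge (T : Affine.Triangle ℝ Plane) (i j : Fin 3) (q : Poly) : ℝ :=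
  ∫ x in edge T i j, value q x ^ 2 ∂lengthMeasure

/-- `r` is the `L²(T)`-orthogonal projection of `ξ` onto the polynomials of degree at most `n`. -/
structure IsL2Projection (T : Affine.Triangle ℝ Plane) (n : ℕ) (ξ r : Poly) : Prop where
  mem : r ∈ polySpace n
  orthogonal : ∀ q ∈ polySpace n, ∫ x in region T, value (ξ - r) x * value q x = 0

theorem continuous_value (q : Poly) : Continuous (value q) :=
  (MvPolynomial.continuous_eval q).comp (PiLp.continuous_ofLp 2 _)

theorem isCompact_region (T : Affine.Triangle ℝ Plane) : IsCompact (region T) :=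
  (Set.finite_range T.points).isCompact_convexHull ℝ

theorem memLp_value (T : Affine.Triangle ℝ Plane) (q : Poly) :
    MemLp (value q) 2 (volume.restrict (region T)) := by
  have hK := isCompact_region T
  have : IsFiniteMeasure (volume.restrict (region T)) :=
    ⟨by simpa using hK.measure_lt_top⟩
  obtain ⟨C, hC⟩ := hK.exists_bound_of_continuousOn (continuous_value q).continuousOn
  refine MemLp.of_bound (continuous_value q).aestronglyMeasurable C ?_
  exact ae_restrict_of_forall_mem hK.measurableSet hC

/-- Polynomials as elements of `L²(T)`. -/
def toL2 (T : Affine.Triangle ℝ Plane) : Poly →ₗ[ℝ] Lp ℝ 2 (volume.restrict (region T)) where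
  toFun q := (memLp_value T q).toLp _
  map_add' q r := by
    rw [← MemLp.toLp_add]
    congr 1
    ext x
    simp [value]
  map_smul' c q := by
    rw [RingHom.id_apply, ← MemLp.toLp_const_smul]
    congr 1
    ext x
    simp [value]

theorem inner_toL2 (T : Affine.Triangle ℝ Plane) (q r : Poly) :
    inner ℝ (toL2 T q) (toL2 T r) = ∫ x in region T, value q x * value r x := by
  rw [L2.inner_def]
  refine integral_congr_ae ?_
  filter_upwards [(memLp_value T q).coeFn_toLp, (memLp_value T r).coeFn_toLp] with x hq hr
  change inner ℝ ((memLp_value T q).toLp _ x) ((memLp_value T r).toLp _ x) = _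
  rw [hq, hr]
  simp [mul_comm]

theorem exists_isL2Projection (T : Affine.Triangle ℝ Plane) (n : ℕ) (ξ : Poly) :
    ∃ r, IsL2Projection T n ξ r := by
  let S := (polySpace n).map (toL2 T)
  obtain ⟨r, hr, h⟩ := S.starProjection_apply_mem (toL2 T ξ)
  refine ⟨r, hr, fun q hq => ?_⟩
  rw [← inner_toL2, map_sub, h]
  exact S.starProjection_inner_eq_zero _ _ ⟨q, hq, rfl⟩

theorem eq_zero_of_integral_sq (T : Affine.Triangle ℝ Plane) (q : Poly)
    (h : ∫ x in region T, value q x * value q x = 0) : q = 0 := by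
  have hspan : affineSpan ℝ (Set.range T.points) = ⊤ :=
    T.independent.affineSpan_eq_top_iff_card_eq_finrank_add_one.2 (by simp)
  obtain ⟨c, hc⟩ := interior_convexHull_nonempty_iff_affineSpan_eq_top.2 hspan
  have hint : Integrable (fun x => value q x * value q x) (volume.restrict (region T)) :=
    (memLp_value T q).integrable_mul (memLp_value T q)
  have hae := (integral_eq_zero_iff_of_nonneg (fun x => mul_self_nonneg _) hint).1 h
  have hae' : (fun x => value q x) =ᵐ[volume.restrict (interior (region T))] fun _ => 0 := by
    filter_upwards [ae_restrict_of_ae_restrict_of_subset interior_subset hae] with x hx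
    exact mul_self_eq_zero.1 hx
  have hzero : Set.EqOn (value q) (fun _ => 0) (interior (region T)) :=
    Measure.eqOn_open_of_ae_eq hae' isOpen_interior (continuous_value q).continuousOn
      continuousOn_const
  have han : AnalyticOnNhd ℝ (value q) Set.univ := by
    have h1 := AnalyticOnNhd.eval_mvPolynomial (𝕜 := ℝ) q
    intro x _
    exact (h1 x.ofLp trivial).comp ((PiLp.continuousLinearEquiv 2 ℝ fun _ : Fin 2 => ℝ).analyticAt x)
  have hall : Set.EqOn (value q) 0 Set.univ :=
    han.eqOn_zero_of_preconnected_of_eventuallyEq_zero isPreconnected_univ (Set.mem_univ c)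
      (by filter_upwards [isOpen_interior.mem_nhds hc] with x hx using hzero hx)
  refine MvPolynomial.funext fun y => ?_
  simpa [value] using hall (Set.mem_univ (WithLp.toLp 2 y))

theorem IsL2Projection.unique {T : Affine.Triangle ℝ Plane} {n : ℕ} {ξ r s : Poly}
    (hr : IsL2Projection T n ξ r) (hs : IsL2Projection T n ξ s) : r = s := by
  have hm : r - s ∈ polySpace n := sub_mem hr.mem hs.mem
  have h1 := hr.orthogonal _ hm
  have h2 := hs.orthogonal _ hm
  rw [← inner_toL2] at h1 h2
  refine sub_eq_zero.1 (eq_zero_of_integral_sq T _ ?_)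
  rw [← inner_toL2]
  have h3 : r - s = (ξ - s) - (ξ - r) := by ring
  nth_rewrite 1 [h3]
  rw [map_sub, inner_sub_left, h1, h2, sub_zero]

/-- The `L²(T)`-orthogonal projection onto the polynomials of total degree at most `n`; it is zero
for negative `n`. -/
def l2Projection (T : Affine.Triangle ℝ Plane) : ℤ → Poly → Poly
  | Int.ofNat n, ξ => (exists_isL2Projection T n ξ).choose
  | Int.negSucc _, _ => 0

theorem l2Projection_eq_iff (T : Affine.Triangle ℝ Plane) (n : ℕ) (ξ r : Poly) :
    l2Projection T n ξ = r ↔ IsL2Projection T n ξ r := by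
  have h : IsL2Projection T n ξ (l2Projection T n ξ) := (exists_isL2Projection T n ξ).choose_spec
  exact ⟨fun e => e ▸ h, fun hr => h.unique hr⟩

end InverseTrace

end

open MeasureTheory

namespace InverseTrace

/-! Let `q` have degree at most `k` and be orthogonal on `T` to lower degrees, and let `a` be the
vertex opposite `F`. The field `q² (x - a)` is tangential on the two edges through `a`, and on `F`
its normal component is `q²` times the height `2|T|/|F|`. The divergence theorem thus gives `‖q‖²_F
= (|F|/|T|) ∫_T q (q + (x - a)·∇q)`. By Euler's identity `(x - a)·∇q` is `k q` plus terms of lower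
degree, which orthogonality removes, so `‖q‖²_F = (k + 1) (|F|/|T|) ‖q‖²_T` exactly
(`normSqEdge_eq_of_orthogonal`).

Now split `θ` into its orthogonal components `θ_k`, `n < k ≤ p`. Cauchy–Schwarz on `F` with weights
`k + 1` bounds `‖θ‖²_F` by `∑ (k + 1)` times `∑ ‖θ_k‖²_F / (k + 1) = (|F|/|T|) ‖θ‖²_T`, and `∑ (k +
1) = (p - n)(p + n + 3)/2`. `normSqEdge_le_of_orthogonal` does this by induction on the number of
components. -/

/-! ### Degree filtration and radial derivative. -/

/-- The polynomials of total degree less than `N`; this is the zero space for `N = 0`. -/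
noncomputable def degLT (N : ℕ) : Submodule ℝ Poly :=
  MvPolynomial.restrictSupport ℝ {e | e.degree < N}

theorem polySpace_eq_degLT (p : ℕ) : polySpace p = degLT (p + 1) := by
  ext q
  simp only [polySpace, MvPolynomial.restrictTotalDegree, degLT, Nat.lt_succ_iff]
  rfl

theorem degLT_zero : degLT 0 = ⊥ := by
  simp [degLT, MvPolynomial.restrictSupport_eq_span]

theorem degLT_mono {M N : ℕ} (h : M ≤ N) : degLT M ≤ degLT N :=
  MvPolynomial.restrictSupport_mono _ fun _ he => lt_of_lt_of_le he h

theorem monomial_mem_degLT {N : ℕ} {e : Fin 2 →₀ ℕ} {r : ℝ} :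
    MvPolynomial.monomial e r ∈ degLT N ↔ e.degree < N ∨ r = 0 :=
  MvPolynomial.monomial_mem_restrictSupport ℝ

/-- The derivative of a polynomial along the radial vector field centred at `a`. -/
noncomputable def radialDeriv (a : Plane) : Poly →ₗ[ℝ] Poly :=
  ∑ i, LinearMap.mulLeft ℝ (MvPolynomial.X i - MvPolynomial.C (a i)) ∘ₗ
    (MvPolynomial.pderiv i).toLinearMap

theorem radialDeriv_apply (a : Plane) (q : Poly) :
    radialDeriv a q =
      ∑ i, (MvPolynomial.X i - MvPolynomial.C (a i)) * MvPolynomial.pderiv i q := by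
  simp [radialDeriv]

theorem pderiv_mem_degLT {N : ℕ} {q : Poly} (i : Fin 2) (hq : q ∈ degLT (N + 1)) :
    MvPolynomial.pderiv i q ∈ degLT N := by
  suffices h : degLT (N + 1) ≤ (degLT N).comap (MvPolynomial.pderiv i).toLinearMap from h hq
  rw [degLT, MvPolynomial.restrictSupport_eq_span, Submodule.span_le]
  rintro _ ⟨e, he, rfl⟩
  simp only [Submodule.comap_coe, Set.mem_preimage, SetLike.mem_coe,
    Derivation.coeFn_coe, MvPolynomial.pderiv_monomial, monomial_mem_degLT]
  rcases Nat.eq_zero_or_pos (e i) with h | h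
  · simp [h]
  · left
    have hle : Finsupp.single i 1 ≤ e := by
      rw [Finsupp.single_le_iff]; exact h
    have hd : (e - Finsupp.single i 1).degree + 1 = e.degree := by
      conv_rhs => rw [← tsub_add_cancel_of_le hle, map_add]
      simp
    simp only [Set.mem_ofPred_eq] at he
    omega

/-- Euler's identity: `∑ X i ∂ i` multiplies a monomial by its degree, so subtracting `k` kills the
part of degree `k`. Moving the centre to `a` only adds first derivatives, which have lower degree.
-/
theorem radialDeriv_sub_smul_mem {k : ℕ} {q : Poly} (a : Plane) (hq : q ∈ degLT (k + 1)) :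
    radialDeriv a q - (k : ℝ) • q ∈ degLT k := by
  have h1 : ∑ i, MvPolynomial.X i * MvPolynomial.pderiv i q - (k : ℝ) • q ∈ degLT k := by
    let E : Poly →ₗ[ℝ] Poly := ∑ i, LinearMap.mulLeft ℝ (MvPolynomial.X i) ∘ₗ
      (MvPolynomial.pderiv i).toLinearMap - (k : ℝ) • LinearMap.id
    have hE (r : Poly) : E r =
        ∑ i, MvPolynomial.X i * MvPolynomial.pderiv i r - (k : ℝ) • r := by simp [E]
    suffices h : degLT (k + 1) ≤ (degLT k).comap E by
      rw [← hE]
      exact h hq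
    rw [degLT, MvPolynomial.restrictSupport_eq_span, Submodule.span_le]
    rintro _ ⟨e, he, rfl⟩
    have hmon : E (MvPolynomial.monomial e 1) =
        MvPolynomial.monomial e ((e.degree : ℝ) - k) := by
      rw [hE, (MvPolynomial.isHomogeneous_monomial (1 : ℝ)
          (rfl : e.degree = e.degree)).sum_X_mul_pderiv,
        ← Nat.cast_smul_eq_nsmul ℝ, ← sub_smul, MvPolynomial.smul_monomial, smul_eq_mul, mul_one]
    simp only [Submodule.comap_coe, Set.mem_preimage, SetLike.mem_coe, hmon, monomial_mem_degLT]
    simp only [Set.mem_ofPred_eq] at he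
    rcases (Nat.lt_succ_iff.1 he).lt_or_eq with h | h
    · exact Or.inl h
    · right; simp [h]
  have h2 : ∑ i, (a i) • MvPolynomial.pderiv i q ∈ degLT k :=
    Submodule.sum_mem _ fun i _ => Submodule.smul_mem _ _ (pderiv_mem_degLT i hq)
  convert sub_mem h1 h2 using 1
  rw [radialDeriv_apply]
  simp only [sub_mul, Finset.sum_sub_distrib, MvPolynomial.smul_eq_C_mul]
  ring

theorem hasDerivAt_value_line (q : Poly) (a w : Plane) (s : ℝ) :
    HasDerivAt (fun s : ℝ => value q (a + s • w))
      (∑ i, w i * value (MvPolynomial.pderiv i q) (a + s • w)) s := by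
  induction q using MvPolynomial.induction_on with
  | C r => simpa [value] using hasDerivAt_const s r
  | add q r hq hr =>
    have h : HasDerivAt (fun s : ℝ => value (q + r) (a + s • w)) _ s :=
      (hq.add hr).congr_of_eventuallyEq (.of_forall fun s => by simp [value])
    refine h.congr_deriv ?_
    simp only [value, map_add, mul_add, Finset.sum_add_distrib]
  | mul_X q n hq =>
    have hX : HasDerivAt (fun s : ℝ => a n + s * w n) (w n) s := by
      simpa using ((hasDerivAt_id s).mul_const (w n)).const_add (a n)
    have h : HasDerivAt (fun s : ℝ => value (q * MvPolynomial.X n) (a + s • w)) _ s :=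
      (hq.mul hX).congr_of_eventuallyEq (.of_forall fun s => by simp [value])
    refine h.congr_deriv ?_
    fin_cases n <;> simp [value] <;> ring

/-- On the ray `x = a + s w` one has `x - a = s w`, so the radial derivative is `s d/ds`. -/
theorem value_radialDeriv (q : Poly) (a w : Plane) (s : ℝ) :
    value (radialDeriv a q) (a + s • w) =
      s * ∑ i, w i * value (MvPolynomial.pderiv i q) (a + s • w) := by
  rw [radialDeriv_apply]
  simp [value, mul_assoc, mul_add]

theorem exists_orthogonal_degLT (T : Affine.Triangle ℝ Plane) (N : ℕ) (ξ : Poly) :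
    ∃ r ∈ degLT N, ∀ q ∈ degLT N, ∫ x in region T, value (ξ - r) x * value q x = 0 := by
  rcases N with _ | N
  · refine ⟨0, zero_mem _, fun q hq => ?_⟩
    rw [degLT_zero, Submodule.mem_bot] at hq
    simp [hq, value]
  · obtain ⟨r, hr⟩ := exists_isL2Projection T N ξ
    rw [← polySpace_eq_degLT]
    exact ⟨r, hr.mem, hr.orthogonal⟩

/-! ### Integrals over edges and triangles in coordinates. -/

/-- The unit-speed parametrization `γ` is an isometry, hence carries Lebesgue measure on the line to
Hausdorff measure on its range; rescaling to `[0, 1]` produces the length as a factor. -/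
theorem integral_edge (b c : Plane) (hbc : b ≠ c) (f : Plane → ℝ) :
    ∫ x in segment ℝ b c, f x ∂lengthMeasure =
      lengthMeasure.real (segment ℝ b c) * ∫ t in (0 : ℝ)..1, f (b + t • (c - b)) := by
  have hL : 0 < ‖c - b‖ := norm_pos_iff.2 (sub_ne_zero.2 hbc.symm)
  have hlen : lengthMeasure.real (segment ℝ b c) = ‖c - b‖ := by
    rw [lengthMeasure, measureReal_def, hausdorffMeasure_segment, edist_dist,
      ENNReal.toReal_ofReal dist_nonneg, dist_comm, dist_eq_norm]
  let γ : ℝ → Plane := fun t => b + (t * ‖c - b‖⁻¹) • (c - b)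
  have hγ : Isometry γ := by
    refine Isometry.of_dist_eq fun s t => ?_
    simp only [γ, dist_eq_norm]
    rw [add_sub_add_left_eq_sub, ← sub_smul, ← sub_mul, norm_smul, norm_mul, norm_inv,
      norm_norm, mul_assoc, inv_mul_cancel₀ hL.ne', mul_one]
  have hemb : MeasurableEmbedding γ := hγ.isClosedEmbedding.measurableEmbedding
  have himg : γ '' Set.Icc 0 ‖c - b‖ = segment ℝ b c := by
    rw [segment_eq_image']
    ext x
    constructor
    · rintro ⟨t, ht, rfl⟩
      exact ⟨t * ‖c - b‖⁻¹, ⟨mul_nonneg ht.1 (by positivity), by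
        rw [← div_eq_mul_inv]; exact div_le_one_of_le₀ ht.2 hL.le⟩, rfl⟩
    · rintro ⟨t, ht, rfl⟩
      refine ⟨t * ‖c - b‖, ⟨mul_nonneg ht.1 hL.le, mul_le_of_le_one_left hL.le ht.2⟩, ?_⟩
      simp only [γ]
      rw [mul_assoc, mul_inv_cancel₀ hL.ne', mul_one]
  have hmap : Measure.map γ volume = lengthMeasure.restrict (Set.range γ) := by
    rw [← hausdorffMeasure_real, hγ.map_hausdorffMeasure (Or.inl zero_le_one), lengthMeasure]
  have hrestr : lengthMeasure.restrict (segment ℝ b c) =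
      (Measure.map γ volume).restrict (segment ℝ b c) := by
    rw [hmap, Measure.restrict_restrict_of_subset]
    rw [← himg]
    exact Set.image_subset_range _ _
  rw [hrestr, hemb.setIntegral_map, ← himg, hγ.injective.preimage_image, himg, hlen,
    integral_Icc_eq_integral_Ioc, ← intervalIntegral.integral_of_le hL.le]
  have h := intervalIntegral.mul_integral_comp_mul_left (a := 0) (b := 1)
    (f := fun t => f (γ t)) ‖c - b‖
  rw [mul_zero, mul_one] at h
  rw [← h]
  congr 1
  refine intervalIntegral.integral_congr fun t _ => ?_
  simp only [γ]
  rw [mul_comm ‖c - b‖ t, mul_assoc, mul_inv_cancel₀ hL.ne', mul_one]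

/-- The triangle with the vertices `(0, 0)`, `(1, 0)` and `(1, 1)`. -/
def unitTriangle : Set (ℝ × ℝ) := {z | 0 ≤ z.2 ∧ z.2 ≤ z.1 ∧ z.1 ≤ 1}

theorem isCompact_unitTriangle : IsCompact unitTriangle := by
  refine (isCompact_Icc (a := ((0 : ℝ), (0 : ℝ))) (b := (1, 1))).of_isClosed_subset ?_ ?_
  · exact (isClosed_le continuous_const continuous_snd).inter
      ((isClosed_le continuous_snd continuous_fst).inter
        (isClosed_le continuous_fst continuous_const))
  · rintro ⟨x, y⟩ ⟨h1, h2, h3⟩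
    exact ⟨⟨h1.trans h2, h1⟩, ⟨h3, h2.trans h3⟩⟩

/-- Fubini with the substitution `y = s t` on each vertical slice; the weight `s` is its Jacobian.
-/
theorem integral_unitTriangle (g : ℝ × ℝ → ℝ) (hg : Continuous g) :
    ∫ z in unitTriangle, g z = ∫ t in (0 : ℝ)..1, ∫ s in (0 : ℝ)..1, s * g (s, s * t) := by
  have hm := isCompact_unitTriangle.measurableSet
  have hi : Integrable (unitTriangle.indicator g) (volume.prod volume) :=
    (integrable_indicator_iff hm).2 (hg.continuousOn.integrableOn_compact isCompact_unitTriangle)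
  rw [intervalIntegral_intervalIntegral_swap]
  swap
  · have hc : Continuous (Function.uncurry fun t s : ℝ => s * g (s, s * t)) := by
      unfold Function.uncurry
      fun_prop
    rw [Set.uIoc_of_le zero_le_one]
    exact (hc.continuousOn.integrableOn_compact (isCompact_Icc.prod isCompact_Icc)).mono_set
      (Set.prod_mono Set.Ioc_subset_Icc_self Set.Ioc_subset_Icc_self)
  rw [← integral_indicator hm, Measure.volume_eq_prod, integral_prod _ hi,
    intervalIntegral.integral_of_le zero_le_one, ← integral_Icc_eq_integral_Ioc,
    ← integral_indicator measurableSet_Icc]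
  congr 1
  ext x
  by_cases hx : x ∈ Set.Icc (0 : ℝ) 1
  · rw [Set.indicator_of_mem hx, intervalIntegral.integral_const_mul,
      intervalIntegral.mul_integral_comp_mul_left (f := fun y => g (x, y)), mul_zero, mul_one,
      intervalIntegral.integral_of_le hx.1, ← integral_Icc_eq_integral_Ioc,
      ← integral_indicator measurableSet_Icc]
    congr 1
    ext y
    have hmem : (x, y) ∈ unitTriangle ↔ y ∈ Set.Icc 0 x :=
      ⟨fun h => ⟨h.1, h.2.1⟩, fun h => ⟨h.1, h.2, hx.2⟩⟩
    by_cases hy : y ∈ Set.Icc 0 x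
    · rw [Set.indicator_of_mem hy, Set.indicator_of_mem (hmem.2 hy)]
    · rw [Set.indicator_of_notMem hy, Set.indicator_of_notMem (mt hmem.1 hy)]
  · rw [Set.indicator_of_notMem hx]
    convert integral_zero ℝ ℝ with y
    refine Set.indicator_of_notMem (fun h => hx ⟨h.1.trans h.2.1, h.2.2⟩) _

theorem mem_convexHull_triple {a b c x : Plane} :
    x ∈ convexHull ℝ {a, b, c} ↔
      ∃ z ∈ unitTriangle, a + (z.1 • (b - a) + z.2 • (c - b)) = x := by
  rw [convexHull_insert (Set.insert_nonempty _ _), convexHull_pair]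
  simp only [mem_convexJoin, Set.mem_singleton_iff, exists_eq_left, segment_eq_image',
    Set.mem_image, exists_exists_and_eq_and]
  constructor
  · rintro ⟨t, ht, s, hs, rfl⟩
    refine ⟨(s, s * t), ⟨mul_nonneg hs.1 ht.1, mul_le_of_le_one_right hs.1 ht.2, hs.2⟩, ?_⟩
    module
  · rintro ⟨⟨s, y⟩, ⟨h0, h1, h2⟩, rfl⟩
    simp only at h0 h1 h2
    -- At `s = 0` the point is the vertex `a` and the ratio `y / s` carries no information.
    rcases (h0.trans h1).eq_or_lt with h | h
    · obtain rfl : y = 0 := le_antisymm (h ▸ h1) h0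
      exact ⟨0, by simp, 0, by simp, by simp [← h]⟩
    · refine ⟨y / s, ⟨by positivity, div_le_one_of_le₀ h1 h.le⟩, s, ⟨h.le, h2⟩, ?_⟩
      have : s * (y / s) = y := by field_simp
      simp only [smul_sub, smul_add, smul_smul, this]
      module

theorem exists_coordinates {a b c : Plane} (h : AffineIndependent ℝ ![a, b, c]) :
    ∃ L : (ℝ × ℝ) ≃L[ℝ] Plane, ∀ z, L z = z.1 • (b - a) + z.2 • (c - b) := by
  let L₀ : (ℝ × ℝ) →ₗ[ℝ] Plane :=
    (LinearMap.fst ℝ ℝ ℝ).smulRight (b - a) + (LinearMap.snd ℝ ℝ ℝ).smulRight (c - b)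
  have hL₀ : ∀ z, L₀ z = z.1 • (b - a) + z.2 • (c - b) := fun z => by simp [L₀]
  have hinj : Function.Injective L₀ := by
    refine (injective_iff_map_eq_zero _).2 fun z hz => ?_
    rw [hL₀] at hz
    -- These are the coefficients of `a`, `b`, `c` in `L₀ z`; they sum to zero.
    have := affineIndependent_iff.1 h Finset.univ ![-z.1, z.1 - z.2, z.2]
      (by simp [Fin.sum_univ_three]; ring) (by
        rw [← hz]; simp [Fin.sum_univ_three]; module)
    have h0 := this 0 (Finset.mem_univ _)
    have h2 := this 2 (Finset.mem_univ _)
    simp at h0 h2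
    exact Prod.ext h0 h2
  exact ⟨(LinearEquiv.ofInjectiveOfFinrankEq L₀ hinj (by simp)).toContinuousLinearEquiv,
    fun z => hL₀ z⟩

theorem integral_convexHull_triple {a b c : Plane} (h : AffineIndependent ℝ ![a, b, c])
    (f : Plane → ℝ) (hf : Continuous f) :
    ∫ x in convexHull ℝ {a, b, c}, f x =
      2 * volume.real (convexHull ℝ {a, b, c}) *
        ∫ t in (0 : ℝ)..1, ∫ s in (0 : ℝ)..1, s * f (a + s • (b - a + t • (c - b))) := by
  obtain ⟨L, hL⟩ := exists_coordinates h
  set K := convexHull ℝ {a, b, c} with hK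
  have hKm : MeasurableSet K :=
    ((Set.toFinite {a, b, c}).isCompact_convexHull ℝ).measurableSet
  have hpre : ∀ z, a + L z ∈ K ↔ z ∈ unitTriangle := fun z => by
    rw [hK, mem_convexHull_triple]
    constructor
    · rintro ⟨w, hw, hwz⟩
      rw [← hL, add_right_inj] at hwz
      rwa [← L.injective hwz]
    · intro hz
      exact ⟨z, hz, by rw [hL]⟩
  -- Uniqueness of Haar measure replaces the determinant of `L` by an unknown constant.
  obtain ⟨κ, hκ⟩ : ∃ κ : NNReal, (volume : Measure Plane) = κ • Measure.map L volume :=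
    ⟨_, Measure.isAddLeftInvariant_eq_smul _ _⟩
  have key : ∀ g : Plane → ℝ, Continuous g → ∫ x in K, g x =
      κ * ∫ t in (0 : ℝ)..1, ∫ s in (0 : ℝ)..1, s * g (a + s • (b - a + t • (c - b))) := by
    intro g hg
    have hLm : MeasurableEmbedding L := L.toHomeomorph.measurableEmbedding
    rw [← integral_indicator hKm, ← integral_add_left_eq_self _ a, hκ,
      integral_smul_nnreal_measure, hLm.integral_map, NNReal.smul_def, smul_eq_mul]
    have : (fun z => K.indicator g (a + L z)) =
        unitTriangle.indicator fun z => g (a + (z.1 • (b - a) + z.2 • (c - b))) := by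
      ext z
      by_cases hz : z ∈ unitTriangle
      · rw [Set.indicator_of_mem hz, Set.indicator_of_mem ((hpre z).2 hz), hL]
      · rw [Set.indicator_of_notMem hz, Set.indicator_of_notMem (mt (hpre z).1 hz)]
    rw [this, integral_indicator isCompact_unitTriangle.measurableSet,
      integral_unitTriangle _ (by fun_prop)]
    simp only [smul_add, smul_smul]
  -- The integrand `1` identifies the constant: the area equals `κ ∫ s ds = κ / 2`.
  have h1 := key (fun _ => 1) continuous_const
  have hκ' : (κ : ℝ) = 2 * volume.real K := by
    simp at h1
    linarith
  rw [key f hf, hκ']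

/-! ### The trace identity for a single degree. -/

theorem value_add (q r : Poly) (x : Plane) : value (q + r) x = value q x + value r x := by
  simp [value]

theorem integrableOn_value_mul (T : Affine.Triangle ℝ Plane) (q r : Poly) :
    Integrable (fun x => value q x * value r x) (volume.restrict (region T)) :=
  (memLp_value T q).integrable_mul (memLp_value T r)

/-- With zero area the constant polynomial `1` would have zero norm. -/
theorem area_pos (T : Affine.Triangle ℝ Plane) : 0 < volume.real (region T) := by
  refine measureReal_nonneg.lt_of_ne fun h => one_ne_zero (α := Poly) ?_
  refine eq_zero_of_integral_sq T 1 ?_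
  simp [value, ← h]

theorem exists_region_eq (T : Affine.Triangle ℝ Plane) {i j : Fin 3} (hij : i ≠ j) :
    ∃ a, AffineIndependent ℝ ![a, T.points i, T.points j] ∧
      region T = convexHull ℝ {a, T.points i, T.points j} := by
  obtain ⟨l, hli, hlj, hl⟩ : ∃ l : Fin 3, l ≠ i ∧ l ≠ j ∧ ∀ m, m = l ∨ m = i ∨ m = j := by
    revert i j; decide
  refine ⟨T.points l, ?_, ?_⟩
  · have hinj : Function.Injective ![l, i, j] := by
      intro x y; fin_cases x <;> fin_cases y <;> simp [hij, hli, hlj, hij.symm, hli.symm, hlj.symm]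
    convert T.independent.comp_embedding ⟨_, hinj⟩ using 1
    ext x : 1
    fin_cases x <;> rfl
  · rw [region]
    congr 1
    ext x
    constructor
    · rintro ⟨m, rfl⟩
      rcases hl m with rfl | rfl | rfl <;> simp
    · rintro (rfl | rfl | rfl) <;> exact Set.mem_range_self _

theorem normSqEdge_eq_integral (T : Affine.Triangle ℝ Plane) {i j : Fin 3} (hij : i ≠ j)
    (q : Poly) :
    normSqEdge T i j q = lengthMeasure.real (edge T i j) *
      ∫ t in (0 : ℝ)..1, value q (T.points i + t • (T.points j - T.points i)) ^ 2 :=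
  integral_edge _ _ (T.independent.injective.ne hij) _

/-- The divergence theorem for the field `q² (x - a)`, where `a` is the vertex opposite to the
edge. -/
theorem exists_normSqEdge_eq_integral_radialDeriv (T : Affine.Triangle ℝ Plane) {i j : Fin 3}
    (hij : i ≠ j) :
    ∃ a : Plane, ∀ q : Poly, normSqEdge T i j q =
      lengthMeasure.real (edge T i j) / volume.real (region T) *
        ∫ x in region T, value q x * value (q + radialDeriv a q) x := by
  obtain ⟨a, ha, hT⟩ := exists_region_eq T hij
  refine ⟨a, fun q => ?_⟩
  have hpos := area_pos T
  rw [normSqEdge_eq_integral T hij, hT,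
    integral_convexHull_triple ha _ ((continuous_value q).fun_mul (continuous_value _)), ← hT]
  set b := T.points i
  set c := T.points j
  have hline : ∀ t : ℝ, ∫ s in (0 : ℝ)..1, s * (value q (a + s • (b - a + t • (c - b))) *
      value (q + radialDeriv a q) (a + s • (b - a + t • (c - b)))) =
      value q (b + t • (c - b)) ^ 2 / 2 := by
    intro t
    set w := b - a + t • (c - b) with hw
    -- The radial integrand is the derivative of `s² q² / 2`: the product rule gives `s q (q + s
    -- dq/ds)`. The factor `s²` removes the contribution of the vertex, leaving the value on the
    -- edge at `s = 1`.
    have hderiv : ∀ s ∈ Set.uIcc (0 : ℝ) 1, HasDerivAt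
        (fun s : ℝ => s ^ 2 * value q (a + s • w) ^ 2 / 2)
        (s * (value q (a + s • w) * value (q + radialDeriv a q) (a + s • w))) s := by
      intro s _
      have h1 := (((hasDerivAt_id s).pow 2).mul ((hasDerivAt_value_line q a w s).pow 2)).div_const 2
      refine h1.congr_deriv ?_
      rw [value_add, value_radialDeriv]
      simp only [id, Pi.pow_apply]
      push_cast
      ring
    have hcont : Continuous fun s : ℝ =>
        s * (value q (a + s • w) * value (q + radialDeriv a q) (a + s • w)) := by
      have h1 := continuous_value q
      have h2 := continuous_value (q + radialDeriv a q)
      fun_prop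
    rw [intervalIntegral.integral_eq_sub_of_hasDerivAt hderiv (hcont.intervalIntegrable _ _)]
    have : a + w = b + t • (c - b) := by rw [hw]; abel
    simp [this]
  simp only [hline, intervalIntegral.integral_div]
  field_simp

/-- The trace identity for the polynomials of degree `k` orthogonal to those of lower degree. -/
theorem normSqEdge_eq_of_orthogonal (T : Affine.Triangle ℝ Plane) {i j : Fin 3} (hij : i ≠ j)
    {k : ℕ} {q : Poly} (hq : q ∈ degLT (k + 1))
    (hort : ∀ r ∈ degLT k, ∫ x in region T, value q x * value r x = 0) :
    normSqEdge T i j q = (k + 1) *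
      (lengthMeasure.real (edge T i j) / volume.real (region T)) * normSqTriangle T q := by
  obtain ⟨a, ha⟩ := exists_normSqEdge_eq_integral_radialDeriv T hij
  have h : ∫ x in region T, value q x * value (q + radialDeriv a q) x =
      (k + 1) * normSqTriangle T q := by
    have h0 := hort _ (radialDeriv_sub_smul_mem a hq)
    have h1 : ∀ x, value q x * value (q + radialDeriv a q) x = (k + 1) * value q x ^ 2 +
        value q x * value (radialDeriv a q - (k : ℝ) • q) x := by
      intro x
      simp only [value, map_add, map_sub, MvPolynomial.smul_eval]
      ring
    simp only [h1]
    rw [integral_add _ (integrableOn_value_mul T _ _), h0, add_zero, integral_const_mul,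
      normSqTriangle]
    simp only [pow_two]
    exact (integrableOn_value_mul T q q).const_mul _
  rw [ha, h]
  ring

/-! ### Summation over the degrees. -/

theorem normSqTriangle_add_of_orthogonal (T : Affine.Triangle ℝ Plane) {q r : Poly}
    (h : ∫ x in region T, value q x * value r x = 0) :
    normSqTriangle T (q + r) = normSqTriangle T q + normSqTriangle T r := by
  have h1 : ∀ x, value (q + r) x ^ 2 =
      value q x * value q x + 2 * (value q x * value r x) + value r x * value r x := by
    intro x
    rw [value_add]
    ring
  have i1 := integrableOn_value_mul T q q
  have i2 := (integrableOn_value_mul T q r).const_mul 2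
  simp only [normSqTriangle, h1]
  rw [integral_add (i1.fun_add i2) (integrableOn_value_mul T r r), integral_add i1 i2,
    integral_const_mul, h]
  simp [pow_two]

/-- Weighted Cauchy–Schwarz for two terms. The free weights let the induction use the sum of the
earlier weights for `α` and the next weight for `β`. -/
theorem normSqEdge_add_le (T : Affine.Triangle ℝ Plane) {i j : Fin 3} (hij : i ≠ j) (q r : Poly)
    {α β : ℝ} (hα : 0 < α) (hβ : 0 < β) :
    normSqEdge T i j (q + r) ≤
      (α + β) * (normSqEdge T i j q / α + normSqEdge T i j r / β) := by
  have hc : ∀ q : Poly, Continuous fun t : ℝ =>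
      value q (T.points i + t • (T.points j - T.points i)) ^ 2 := fun q => by
    have := continuous_value q
    fun_prop
  have hle : ∫ t in (0 : ℝ)..1, value (q + r) (T.points i + t • (T.points j - T.points i)) ^ 2 ≤
      ∫ t in (0 : ℝ)..1, (α + β) *
        (value q (T.points i + t • (T.points j - T.points i)) ^ 2 / α +
          value r (T.points i + t • (T.points j - T.points i)) ^ 2 / β) := by
    refine intervalIntegral.integral_mono_on zero_le_one ((hc _).intervalIntegrable _ _)
      ((((hc q).div_const α).add ((hc r).div_const β)).const_mul _ |>.intervalIntegrable _ _) ?_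
    intro t _
    rw [value_add]
    generalize value q _ = u
    generalize value r _ = v
    have : (α + β) * (u ^ 2 / α + v ^ 2 / β) - (u + v) ^ 2 = (β * u - α * v) ^ 2 / (α * β) := by
      field_simp
      ring
    have : 0 ≤ (β * u - α * v) ^ 2 / (α * β) := by positivity
    linarith
  rw [intervalIntegral.integral_const_mul, intervalIntegral.integral_add
    (((hc q).div_const α).intervalIntegrable _ _) (((hc r).div_const β).intervalIntegrable _ _),
    intervalIntegral.integral_div, intervalIntegral.integral_div] at hle
  simp only [normSqEdge_eq_integral T hij]
  refine (mul_le_mul_of_nonneg_left hle measureReal_nonneg).trans_eq ?_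
  ring

/-- The constant `d (2 m + d + 1) / 2` is the sum of `k + 1` over the `d` degrees `m ≤ k < m + d`.
-/
theorem normSqEdge_le_of_orthogonal (T : Affine.Triangle ℝ Plane) {i j : Fin 3} (hij : i ≠ j)
    {m : ℕ} (d : ℕ) {θ : Poly} (hθ : θ ∈ degLT (m + d))
    (hort : ∀ r ∈ degLT m, ∫ x in region T, value θ x * value r x = 0) :
    normSqEdge T i j θ ≤ (d * (2 * m + d + 1) / 2 : ℝ) *
      (lengthMeasure.real (edge T i j) / volume.real (region T)) * normSqTriangle T θ := by
  induction d generalizing θ with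
  | zero =>
    obtain rfl := eq_zero_of_integral_sq T θ (hort θ hθ)
    simp [normSqEdge, value]
  | succ d ih =>
    -- Peel off the component `v = θ - u` of top degree `m + d`; the rest `u` stays orthogonal to
    -- `degLT m`.
    obtain ⟨u, hu, huort⟩ := exists_orthogonal_degLT T (m + d) θ
    set v := θ - u with hv
    have hvmem : v ∈ degLT (m + d + 1) := sub_mem hθ (degLT_mono (Nat.le_succ _) hu)
    have hvF := normSqEdge_eq_of_orthogonal T hij hvmem huort
    have huv : ∫ x in region T, value u x * value v x = 0 := by
      simpa only [mul_comm] using huort u hu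
    have hθuv : θ = u + v := by rw [hv]; abel
    have hu' : ∀ r ∈ degLT m, ∫ x in region T, value u x * value r x = 0 := by
      intro r hr
      have h1 := hort r hr
      rw [hθuv] at h1
      simp only [value_add, add_mul] at h1
      rwa [integral_add (integrableOn_value_mul T _ _) (integrableOn_value_mul T _ _),
        huort r (degLT_mono (Nat.le_add_right _ _) hr), add_zero] at h1
    have huF := ih hu hu'
    set γ := lengthMeasure.real (edge T i j) / volume.real (region T)
    have hγ : 0 ≤ γ := div_nonneg measureReal_nonneg measureReal_nonneg
    rw [hθuv, normSqTriangle_add_of_orthogonal T huv]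
    -- For `d = 0` the weight of `u` would be zero; but then `u` is orthogonal to itself and
    -- vanishes.
    rcases Nat.eq_zero_or_pos d with rfl | hd
    · obtain rfl := eq_zero_of_integral_sq T u (hu' u hu)
      rw [zero_add, hvF]
      have h0 : normSqTriangle T 0 = 0 := by simp [normSqTriangle, value]
      refine le_of_eq ?_
      rw [h0]
      push_cast
      ring
    · have hα : (0 : ℝ) < d * (2 * m + d + 1) / 2 := by positivity
      have hβ : (0 : ℝ) < (m + d : ℕ) + 1 := by positivity
      refine (normSqEdge_add_le T hij u v hα hβ).trans ?_
      have h1 : normSqEdge T i j u / (d * (2 * m + d + 1) / 2 : ℝ) ≤ γ * normSqTriangle T u := by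
        rw [div_le_iff₀ hα]
        linarith
      have h2 : normSqEdge T i j v / ((m + d : ℕ) + 1 : ℝ) = γ * normSqTriangle T v := by
        rw [div_eq_iff hβ.ne', hvF]
        ring
      rw [h2]
      refine (mul_le_mul_of_nonneg_left (add_le_add_left h1 _) (add_pos hα hβ).le).trans_eq ?_
      push_cast
      ring

end InverseTrace

/-! ### The trace inequality. -/

theorem mainTheorem3 (T : Affine.Triangle ℝ InverseTrace.Plane) (i j : Fin 3) (hij : i ≠ j)
    (p : ℕ) (n : ℤ) (hn : -1 ≤ n) (hnp : n ≤ p)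
    (ξ : InverseTrace.Poly) (hξ : ξ ∈ InverseTrace.polySpace p) :
    InverseTrace.normSqEdge T i j (ξ - InverseTrace.l2Projection T n ξ) ≤
      ((p : ℝ) - n) * ((p : ℝ) + n + 3) / 2 *
        (InverseTrace.lengthMeasure.real (InverseTrace.edge T i j) /
          (MeasureTheory.volume : MeasureTheory.Measure InverseTrace.Plane).real
            (InverseTrace.region T)) *
        InverseTrace.normSqTriangle T (ξ - InverseTrace.l2Projection T n ξ) := by
  open InverseTrace in
  -- The shift `m = n + 1` turns degree at most `n` into degree less than `m`, so that `n = -1`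
  -- becomes the zero space `degLT 0`; correspondingly `d = p - n` counts the degrees.
  obtain ⟨m, rfl⟩ : ∃ m : ℕ, n = m - 1 := ⟨(n + 1).toNat, by omega⟩
  obtain ⟨d, hd⟩ : ∃ d : ℕ, p + 1 = m + d := ⟨p + 1 - m, by omega⟩
  have hproj : l2Projection T (m - 1) ξ ∈ degLT m ∧ ∀ r ∈ degLT m,
      ∫ x in region T, value (ξ - l2Projection T (m - 1) ξ) x * value r x = 0 := by
    rcases m with _ | m
    · rw [degLT_zero]
      refine ⟨rfl, fun r hr => ?_⟩
      rw [(Submodule.mem_bot ℝ).1 hr]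
      simp [value]
    · have h := (l2Projection_eq_iff T m ξ _).1 rfl
      rw [← polySpace_eq_degLT]
      push_cast
      rw [add_sub_cancel_right]
      exact ⟨h.mem, h.orthogonal⟩
  rw [polySpace_eq_degLT, hd] at hξ
  refine (normSqEdge_le_of_orthogonal T hij d
    (sub_mem hξ (degLT_mono (Nat.le_add_right m d) hproj.1)) hproj.2).trans_eq ?_
  have hp : (p : ℝ) = m + d - 1 := by
    rw [eq_sub_iff_add_eq]
    exact_mod_cast hd
  rw [hp]
  push_cast
  ring
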